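/- A \emph{Bratteli diagram} $B$ is an infinite graph with vertex set $\bigsqcup_{n\ge 0}V_n$ and edge set $\bigsqcup_{n\ge 1}E_n$, all $V_n$ and $E_n$ finite and $V_0$ a single vertex, with source and range maps $s:E_n\to V_{n-1}$ and $r:E_n\to V_n$ that are surjective for every $n\ge 1$. For $n \geq 0$ its incidence matrix $F_n=(f^{(n)}_{vw})_{v\in V_{n+1},w\in V_n}$ has as entry $f^{(n)}_{vw}$ the number of edges $e\in E_{n+1}$ with $s(e)=w$ and $r(e)=v$. The diagram is \emph{stationary} if the levels $V_1,V_2,\dots$ can be identified with one finite set so that $F_n=F_1$ for all $n\ge 1$. Let $X_B$ be the space of infinite paths $x=(x_1,x_2,\dots)$, $x_i\in E_i$, $r(x_i)=s(x_{i+1})$, with the topology generated by the cylinder sets $\{x : x_1=e_1,\dots,x_n=e_n\}$. Two paths are \emph{tail equivalent} if they agree from some index on. A Borel measure on $X_B$ is \emph{tail-invariant} if any two cylinder sets given by finite paths $(e_1,\dots,e_n)$ and $(e_1',\dots,e_n')$ with $r(e_n)=r(e_n')$ have the same measure; a tail-invariant Borel probability measure is \emph{ergodic} if every Borel set that is a union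 of tail equivalence classes has measure $0$ or $1$. For a Borel probability measure $\nu$ on a topological space $X$ that is positive on all non-empty clopen sets, put $S(\nu)=\{\nu(U): U\subset X \text{ clopen}\}$, and for a non-empty clopen set $U$ put $\nu_U(A)=\nu(A\cap U)/\nu(U)$. The measure $\nu$ satisfies the \emph{Quotient Condition} if $S(\nu_U)=S(\nu)$ for every non-empty clopen $U\subset X$. \textbf{Proposition.} Let $B$ be a stationary Bratteli diagram and let $\mu$ be a non-atomic ergodic tail-invariant Borel probability measure on $X_B$. Then $\mu$, regarded as a measure on its topological support $\operatorname{supp}(\mu)\subset X_B$, does not satisfy the Quotient Condition: there is a non-empty clopen subset $U$ of $\operatorname{supp}(\mu)$ with $S(\mu_U)\ne S(\mu)$. -/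

import Mathlib

open MeasureTheory

universe u v

/-- A Bratteli diagram: a graded graph with vertex sets `V 0, V 1, ...` and edge sets, where
`E n` is the set of edges going from level `n` to level `n + 1`. -/
structure BratteliDiagram where
  V : ℕ → Type u
  E : ℕ → Type v
  /-- the source map -/
  s : ∀ {n : ℕ}, E n → V n
  /-- the range map -/
  r : ∀ {n : ℕ}, E n → V (n + 1)
  finite_V : ∀ n, Finite (V n)
  finite_E : ∀ n, Finite (E n)
  /-- the top level is a single vertex -/
  card_V_zero : Nat.card (V 0) = 1
  /-- every vertex is the source of some edge -/
  s_surjective : ∀ n, Function.Surjective (s : E n → V n)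
  /-- every vertex below the top level is the range of some edge -/
  r_surjective : ∀ n, Function.Surjective (r : E n → V (n + 1))

namespace BratteliDiagram

/-- The incidence matrix between levels `n` and `n + 1`: its entry `(v, w)` is the number of edges
from `w` to `v`. -/
noncomputable def incidence (B : BratteliDiagram) (n : ℕ) : Matrix (B.V (n + 1)) (B.V n) ℕ :=
  fun v w => Nat.card {e : B.E n // B.r e = v ∧ B.s e = w}

/-- `B` is stationary if all levels from the first on can be enumerated by one index set so that
the incidence matrices between consecutive levels `1, 2, 3, ...` are all equal. No condition is
imposed on the edges between level `0` and level `1`. -/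
def IsStationary (B : BratteliDiagram) : Prop :=
  ∃ (K : ℕ) (F : Matrix (Fin K) (Fin K) ℕ) (σ : ∀ n, Fin K ≃ B.V (n + 1)),
    ∀ n, (B.incidence (n + 1)).submatrix (σ (n + 1)) (σ n) = F

/-- The path space: all infinite paths, starting at the vertex of level `0`. -/
def PathSpace (B : BratteliDiagram) : Type _ :=
  {x : ∀ n, B.E n // ∀ n, B.r (x n) = B.s (x (n + 1))}

/-- The topology generated by the cylinder sets, i.e. the one induced by the product of the
discrete topologies on the edge sets. -/
instance (B : BratteliDiagram) : TopologicalSpace B.PathSpace :=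
  TopologicalSpace.induced (fun x => x.1) (@Pi.topologicalSpace ℕ B.E (fun _ => ⊥))

instance (B : BratteliDiagram) : MeasurableSpace B.PathSpace := borel _

instance (B : BratteliDiagram) : BorelSpace B.PathSpace := ⟨rfl⟩

/-- The cylinder set given by the first `n` edges of `x`. As every finite path extends to an
infinite one, every cylinder set has this form. -/
def cylinder (B : BratteliDiagram) (n : ℕ) (x : B.PathSpace) : Set B.PathSpace :=
  {y | ∀ i < n, y.1 i = x.1 i}

/-- Two infinite paths are tail equivalent if they agree from some level on. -/
def TailEquiv (B : BratteliDiagram) (x y : B.PathSpace) : Prop :=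
  ∃ N, ∀ i, N ≤ i → x.1 i = y.1 i

/-- `μ` is invariant under the tail equivalence relation: any two cylinder sets given by finite
paths (here of length `n + 1`) from the top vertex to the same vertex have the same measure. -/
def IsTailInvariant (B : BratteliDiagram) (μ : Measure B.PathSpace) : Prop :=
  ∀ (n : ℕ) (x y : B.PathSpace), B.r (x.1 n) = B.r (y.1 n) →
    μ (B.cylinder (n + 1) x) = μ (B.cylinder (n + 1) y)

/-- The probability measure `μ` is ergodic for the tail equivalence relation: every Borel set that
is a union of tail equivalence classes has measure `0` or `1`. -/
def IsTailErgodic (B : BratteliDiagram) (μ : Measure B.PathSpace) : Prop :=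
  ∀ A : Set B.PathSpace, MeasurableSet A → (∀ x y, B.TailEquiv x y → x ∈ A → y ∈ A) →
    μ A = 0 ∨ μ A = 1

end BratteliDiagram

section ClopenValues

variable {X : Type*} [TopologicalSpace X] [MeasurableSpace X]

/-- The clopen values set `S(μ)`. -/
def clopenValues (μ : Measure X) : Set ℝ :=
  {t | ∃ U : Set X, IsClopen U ∧ μ.real U = t}

/-- A clopen set `U` is of `μ` type if `S(μ_U) = S(μ)`, where `μ_U` is the relative measure
`μ_U(A) = μ(A ∩ U) / μ(U)`. -/
def IsOfMeasureType (μ : Measure X) (U : Set X) : Prop :=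
  clopenValues (ProbabilityTheory.cond μ U) = clopenValues μ

/-- The Quotient Condition: every non-empty clopen set is of `μ` type. It is meant for measures
that are positive on all non-empty clopen sets. -/
def QuotientCondition (μ : Measure X) : Prop :=
  ∀ U : Set X, IsClopen U → U.Nonempty → IsOfMeasureType μ U

/-- `μ` regarded as a measure on its topological support, the smallest closed set of full measure;
this is where `μ` is positive on non-empty open sets. -/
noncomputable def onSupport (μ : Measure X) : Measure μ.support :=
  μ.comap Subtype.val

end ClopenValues

/-! ### Integer recurrences and denominators of rational numbers -/

section NumberTheory

/-! The Quotient Condition would put every unit fraction into `S(μ)`, while stationarity keeps some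
unit fraction out. For the first half, non-atomicity makes long cylinders small, hence numerous, and
the levels have bounded size; by pigeonhole, `k` disjoint cylinders of equal positive measure end at
one vertex. If `U` is their union, each has `μ_U`-measure `1/k`, so `1/k ∈ S(μ_U) = S(μ)`
(`inv_mem_clopenValues`). For the second half, every clopen value is an integer combination of the
weights `q n` of one level, and `q n = Fᵀ q (n + 1)` with `F` fixed. By Cayley–Hamilton the `q n`
satisfy an integer recurrence. If `D` is its lowest nonzero coefficient, all `q n` lie in `H[1/D]`
for a finitely generated group `H` of reals. Rational numbers in `H` have bounded denominators, so
`1/p ∉ H[1/D]` for a large prime `p` (`exists_inv_notMem_span`). -/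

open Polynomial in
/-- A sequence of vectors with `q n = A q (n + 1)` satisfies the linear recurrence given by the
characteristic polynomial of the integer matrix `A`. -/
theorem exists_monic_recurrence {ι : Type*} [Fintype ι] (F : Matrix ι ι ℕ) (q : ℕ → ι → ℝ)
    (h : ∀ n i, q n i = ∑ j, (F j i : ℝ) * q (n + 1) j) :
    ∃ f : ℤ[X], f.Monic ∧ ∀ n i,
      ∑ k ∈ Finset.range (f.natDegree + 1), (f.coeff k : ℝ) * q (n + (f.natDegree - k)) i = 0 := by
  classical
  let A : Matrix ι ι ℤ := (F.map (Nat.cast : ℕ → ℤ)).transpose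
  let AR : Matrix ι ι ℝ := A.map (Int.castRingHom ℝ)
  have hq : ∀ n, q n = AR.mulVec (q (n + 1)) := by
    intro n
    ext i
    rw [h n i]
    simp [AR, A, Matrix.mulVec, dotProduct]
  have hpow : ∀ k n, q n = (AR ^ k).mulVec (q (n + k)) := by
    intro k
    induction k with
    | zero => simp
    | succ k ih =>
      intro n
      rw [pow_succ, ← Matrix.mulVec_mulVec, ← add_assoc, ← hq, ← ih]
  refine ⟨A.charpoly, A.charpoly_monic, fun n i => ?_⟩
  have hdeg : AR.charpoly.natDegree = A.charpoly.natDegree := by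
    rw [AR.charpoly_natDegree_eq_dim, A.charpoly_natDegree_eq_dim]
  have h0 := AR.aeval_self_charpoly
  rw [aeval_eq_sum_range, hdeg] at h0
  have h1 := congrFun (congrArg (fun M => M.mulVec (q (n + A.charpoly.natDegree))) h0) i
  simp only [Matrix.sum_mulVec, Finset.sum_apply, Matrix.zero_mulVec, Pi.zero_apply,
    Matrix.smul_mulVec, Pi.smul_apply, smul_eq_mul] at h1
  rw [← h1]
  refine Finset.sum_congr rfl fun k hk => ?_
  have hk' : k ≤ A.charpoly.natDegree := by simpa [Nat.lt_succ_iff] using hk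
  have e := hpow k (n + (A.charpoly.natDegree - k))
  rw [show n + (A.charpoly.natDegree - k) + k = n + A.charpoly.natDegree by omega] at e
  rw [e, A.charpoly_map (Int.castRingHom ℝ), coeff_map]
  rfl

/-- The elements which some power of `D` multiplies into `H`. -/
def Submodule.powSaturation (H : Submodule ℤ ℝ) (D : ℤ) : Submodule ℤ ℝ where
  carrier := {x | ∃ m : ℕ, D ^ m • x ∈ H}
  zero_mem' := ⟨0, by simp⟩
  add_mem' := by
    rintro x y ⟨m, hm⟩ ⟨n, hn⟩
    refine ⟨m + n, ?_⟩
    have e : D ^ (m + n) • (x + y) = D ^ n • (D ^ m • x) + D ^ m • (D ^ n • y) := by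
      simp only [smul_smul, smul_add, pow_add, mul_comm]
    rw [e]
    exact H.add_mem (H.smul_mem _ hm) (H.smul_mem _ hn)
  smul_mem' := by
    rintro c x ⟨m, hm⟩
    exact ⟨m, by rw [smul_comm]; exact H.smul_mem _ hm⟩

theorem Submodule.le_powSaturation (H : Submodule ℤ ℝ) (D : ℤ) : H ≤ H.powSaturation D :=
  fun x hx => ⟨0, by simpa using hx⟩

theorem Submodule.mem_powSaturation_of_smul_mem {H : Submodule ℤ ℝ} {D : ℤ} {x : ℝ}
    (hx : D • x ∈ H.powSaturation D) : x ∈ H.powSaturation D := by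
  obtain ⟨m, hm⟩ := hx
  exact ⟨m + 1, by rwa [pow_succ, mul_smul]⟩

/-- A finitely generated group of reals contains rational numbers of bounded denominator only. -/
theorem exists_int_mul_of_fg {H : Submodule ℤ ℝ} (hH : H.FG) :
    ∃ M : ℤ, M ≠ 0 ∧ ∀ x : ℚ, (x : ℝ) ∈ H → ∃ z : ℤ, (M : ℚ) * x = z := by
  let g : ℚ →ₗ[ℤ] ℝ := (Rat.castHom ℝ).toAddMonoidHom.toIntLinearMap
  have hg : Function.Injective g := Rat.cast_injective
  -- Since `ℤ` is Noetherian, `H ∩ ℚ` is finitely generated too, hence a fractional ideal of `ℤ`.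
  have hfg : (H.comap g).FG := by
    have : IsNoetherian ℤ H := isNoetherian_of_fg_of_noetherian H hH
    have h1 : ((H.comap g).map g).FG :=
      isNoetherian_submodule.1 this _ (Submodule.map_comap_le g H)
    exact Submodule.fg_of_fg_map_injective g hg h1
  obtain ⟨M, hM, hI⟩ := FractionalIdeal.isFractional_of_fg (S := nonZeroDivisors ℤ) hfg
  refine ⟨M, nonZeroDivisors.ne_zero hM, fun x hx => ?_⟩
  obtain ⟨z, hz⟩ := hI x hx
  exact ⟨z, by simpa using hz.symm⟩

/-- If `M` clears the denominators of `H ∩ ℚ`, then `D ^ m / p ∈ H` forces `p ∣ M * D ^ m`, which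
fails for a prime `p` exceeding `|M|` and `|D|`. -/
theorem exists_inv_notMem_powSaturation {H : Submodule ℤ ℝ} (hH : H.FG) {D : ℤ} (hD : D ≠ 0) :
    ∃ k : ℕ, 0 < k ∧ (k : ℝ)⁻¹ ∉ H.powSaturation D := by
  obtain ⟨M, hM, hMx⟩ := exists_int_mul_of_fg hH
  obtain ⟨p, hp, hprime⟩ := Nat.exists_infinite_primes (M.natAbs + D.natAbs + 1)
  refine ⟨p, hprime.pos, ?_⟩
  rintro ⟨m, hm⟩
  have hp0 : (p : ℚ) ≠ 0 := by exact_mod_cast hprime.ne_zero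
  obtain ⟨z, hz⟩ := hMx ((D : ℚ) ^ m * (p : ℚ)⁻¹) (by
    push_cast
    simpa [zsmul_eq_mul] using hm)
  have h1 : M * D ^ m = p * z := by
    field_simp at hz
    exact_mod_cast hz
  have hpi : Prime (p : ℤ) := Nat.prime_iff_prime_int.1 hprime
  have hdvd : (p : ℤ) ∣ M * D ^ m := ⟨z, h1⟩
  rcases hpi.dvd_or_dvd hdvd with h | h
  · have := Nat.le_of_dvd (Int.natAbs_pos.2 hM) (Int.natCast_dvd.1 h)
    omega
  · have := Nat.le_of_dvd (Int.natAbs_pos.2 hD) (Int.natCast_dvd.1 (hpi.dvd_of_dvd_pow h))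
    omega

/-- If `q n = Fᵀ q (n + 1)` for a fixed integer matrix `F`, then some unit fraction is not an
integral combination of the coordinates of any of the `q n`. -/
theorem exists_inv_notMem_span {ι : Type*} [Finite ι] (F : Matrix ι ι ℕ) (q : ℕ → ι → ℝ)
    (h : ∀ n i, q n i = ∑ᶠ j, (F j i : ℝ) * q (n + 1) j) :
    ∃ k : ℕ, 0 < k ∧ ∀ n, (k : ℝ)⁻¹ ∉ Submodule.span ℤ (Set.range (q n)) := by
  have := Fintype.ofFinite ι
  simp only [finsum_eq_sum_of_fintype] at h
  obtain ⟨f, hf, hrec⟩ := exists_monic_recurrence F q h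
  set d := f.natDegree
  set t := f.natTrailingDegree
  have htd : t ≤ d := f.natTrailingDegree_le_natDegree
  -- `F` may be singular, so the constant coefficient can vanish; the trailing one cannot.
  have hD : f.coeff t ≠ 0 := Polynomial.trailingCoeff_nonzero_iff_nonzero.2 hf.ne_zero
  let S : Set ℝ := Set.range fun a : Fin (d + 1) × ι => q a.1 a.2
  let H : Submodule ℤ ℝ := Submodule.span ℤ S
  have hH : H.FG := Submodule.fg_span (Set.finite_range _)
  have key : ∀ n i, q n i ∈ H.powSaturation (f.coeff t) := by
    intro n
    induction n using Nat.strong_induction_on with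
    | _ n ih =>
      intro i
      by_cases hn : n ≤ d
      · exact H.le_powSaturation _ (Submodule.subset_span ⟨(⟨n, by omega⟩, i), rfl⟩)
      apply Submodule.mem_powSaturation_of_smul_mem
      -- With this shift the term `k = t` is `q n`: terms with `k < t` vanish, and those with `k >
      -- t` have smaller index.
      have hr := hrec (n - (d - t)) i
      rw [← Finset.add_sum_erase _ _ (Finset.mem_range.2 (Nat.lt_succ_of_le htd)),
        show n - (d - t) + (d - t) = n by omega, add_eq_zero_iff_eq_neg] at hr
      rw [zsmul_eq_mul, hr]
      refine Submodule.neg_mem _ (Submodule.sum_mem _ fun k hk => ?_)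
      rw [Finset.mem_erase, Finset.mem_range] at hk
      rcases lt_or_gt_of_ne hk.1 with hlt | hgt
      · rw [Polynomial.coeff_eq_zero_of_lt_natTrailingDegree hlt]
        simp
      · rw [← zsmul_eq_mul]
        exact Submodule.smul_mem _ _ (ih _ (by omega) i)
  obtain ⟨k, hk, hkn⟩ := exists_inv_notMem_powSaturation hH hD
  refine ⟨k, hk, fun n hmem => hkn (Submodule.span_le.2 ?_ hmem)⟩
  rintro _ ⟨i, rfl⟩
  exact key n i

end NumberTheory

namespace BratteliDiagram

variable (B : BratteliDiagram.{u, v})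

instance (n : ℕ) : Finite (B.E n) := B.finite_E n

instance (n : ℕ) : Finite (B.V n) := B.finite_V n

/-! ### Constructing infinite paths -/

section Paths

variable {B}

/-- The sequence `g` need not be composable: the path takes the edge of `g` whenever it can and any
continuation otherwise. This allows finitely many edges to be prescribed without concatenating
paths. -/
theorem exists_path_following (g : ∀ n, B.E n) :
    ∃ y : B.PathSpace, y.1 0 = g 0 ∧
      ∀ i, B.r (y.1 i) = B.s (g (i + 1)) → y.1 (i + 1) = g (i + 1) := by
  classical
  let z : ∀ n, B.E n := fun n => Nat.rec (motive := B.E) (g 0)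
    (fun i e => if B.r e = B.s (g (i + 1)) then g (i + 1)
      else (B.s_surjective (i + 1) (B.r e)).choose) n
  have hz : ∀ i, z (i + 1) = if B.r (z i) = B.s (g (i + 1)) then g (i + 1)
      else (B.s_surjective (i + 1) (B.r (z i))).choose := fun i => rfl
  refine ⟨⟨z, fun i => ?_⟩, rfl, fun i hi => ?_⟩
  · rw [hz]
    split_ifs with h
    · exact h
    · exact (B.s_surjective (i + 1) (B.r (z i))).choose_spec.symm
  · exact (hz i).trans (if_pos hi)

/-- Any initial segment of a path, followed by a composable edge, extends to an infinite path. -/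
theorem exists_path_extending (x : B.PathSpace) (n : ℕ) (e : B.E (n + 1))
    (he : B.r (x.1 n) = B.s e) :
    ∃ y : B.PathSpace, (∀ i ≤ n, y.1 i = x.1 i) ∧ y.1 (n + 1) = e := by
  classical
  obtain ⟨y, hy0, hy⟩ := exists_path_following (Function.update x.1 (n + 1) e)
  have hle : ∀ i ≤ n, y.1 i = x.1 i := by
    intro i
    induction i with
    | zero =>
      intro _
      rw [hy0, Function.update_of_ne (by omega)]
    | succ i ih =>
      intro hi
      have hne : i + 1 ≠ n + 1 := by omega
      have h1 := hy i
      rw [Function.update_of_ne hne] at h1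
      exact h1 (by rw [ih (by omega), x.2 i])
  refine ⟨y, hle, ?_⟩
  have h1 := hy n
  rw [Function.update_self] at h1
  exact h1 (by rw [hle n le_rfl, he])

theorem exists_path_through [Nonempty B.PathSpace] (n : ℕ) (e : B.E n) :
    ∃ y : B.PathSpace, y.1 n = e := by
  classical
  induction n with
  | zero =>
    obtain ⟨y, hy, -⟩ :=
      exists_path_following (Function.update (Classical.arbitrary B.PathSpace).1 0 e)
    exact ⟨y, by rw [hy, Function.update_self]⟩
  | succ n ih =>
    obtain ⟨e', he'⟩ := B.r_surjective n (B.s e)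
    obtain ⟨x, hx⟩ := ih e'
    obtain ⟨y, -, hy⟩ := exists_path_extending x n e (by rw [hx, he'])
    exact ⟨y, hy⟩

theorem exists_path_to [Nonempty B.PathSpace] (n : ℕ) (v : B.V (n + 1)) :
    ∃ y : B.PathSpace, B.r (y.1 n) = v := by
  obtain ⟨e, rfl⟩ := B.r_surjective n v
  obtain ⟨y, hy⟩ := exists_path_through n e
  exact ⟨y, by rw [hy]⟩

/-- The initial segment of length `n` of a path. -/
def head (n : ℕ) (x : B.PathSpace) : ∀ i : Fin n, B.E i := fun i => x.1 i

theorem head_eq_iff {n : ℕ} {x y : B.PathSpace} : head n x = head n y ↔ ∀ i < n, x.1 i = y.1 i :=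
  ⟨fun h i hi => congrFun h ⟨i, hi⟩, fun h => funext fun i => h i i.2⟩

theorem cylinder_eq_preimage_head (n : ℕ) (x : B.PathSpace) :
    B.cylinder n x = head n ⁻¹' {head n x} := by
  ext y
  exact head_eq_iff.symm

theorem mem_cylinder_self (n : ℕ) (x : B.PathSpace) : x ∈ B.cylinder n x := fun _ _ => rfl

theorem cylinder_anti (x : B.PathSpace) : Antitone fun n => B.cylinder n x :=
  fun _ _ h _ hy i hi => hy i (hi.trans_le h)

theorem iInter_cylinder (x : B.PathSpace) : ⋂ n, B.cylinder n x = {x} := by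
  ext y
  simp only [Set.mem_iInter, Set.mem_singleton_iff]
  refine ⟨fun h => Subtype.ext (funext fun i => h (i + 1) i (Nat.lt_succ_self i)), ?_⟩
  rintro rfl n
  exact mem_cylinder_self n y

end Paths

/-! ### Compactness of the path space and clopen sets -/

section Topology

variable {B}

theorem continuous_edge (i : ℕ) : @Continuous _ (B.E i) _ ⊥ fun x : B.PathSpace => x.1 i := by
  let _ : ∀ n, TopologicalSpace (B.E n) := fun _ => ⊥
  exact (continuous_apply i).comp continuous_induced_dom

theorem isOpen_preimage_edge (i : ℕ) (A : Set (B.E i)) :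
    IsOpen ((fun x : B.PathSpace => x.1 i) ⁻¹' A) := by
  let _ : TopologicalSpace (B.E i) := ⊥
  have : DiscreteTopology (B.E i) := ⟨rfl⟩
  exact (isOpen_discrete A).preimage (continuous_edge i)

theorem isOpen_cylinder (n : ℕ) (x : B.PathSpace) : IsOpen (B.cylinder n x) := by
  have : B.cylinder n x = ⋂ i ∈ Finset.range n, (fun y : B.PathSpace => y.1 i) ⁻¹' {x.1 i} := by
    ext y
    simp [cylinder]
  rw [this]
  exact isOpen_biInter_finset fun i _ => isOpen_preimage_edge i _

theorem isOpen_preimage_head (n : ℕ) (C : Set (∀ i : Fin n, B.E i)) :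
    IsOpen (head n ⁻¹' C : Set B.PathSpace) := by
  have : (head n ⁻¹' C : Set B.PathSpace) = ⋃ x ∈ (head n ⁻¹' C : Set B.PathSpace),
      B.cylinder n x := by
    ext y
    simp only [Set.mem_iUnion]
    refine ⟨fun hy => ⟨y, hy, mem_cylinder_self n y⟩, ?_⟩
    rintro ⟨x, hx, hy⟩
    rw [cylinder_eq_preimage_head] at hy
    rw [Set.mem_preimage, show head n y = head n x from hy]
    exact hx
  rw [this]
  exact isOpen_biUnion fun x _ => isOpen_cylinder n x

theorem isClopen_preimage_head (n : ℕ) (C : Set (∀ i : Fin n, B.E i)) :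
    IsClopen (head n ⁻¹' C : Set B.PathSpace) :=
  ⟨⟨by rw [← Set.preimage_compl]; exact isOpen_preimage_head n _⟩, isOpen_preimage_head n C⟩

instance : CompactSpace B.PathSpace := by
  let _ : ∀ n, TopologicalSpace (B.E n) := fun _ => ⊥
  have : ∀ n, DiscreteTopology (B.E n) := fun _ => ⟨rfl⟩
  have hc : IsClosed {x : ∀ n, B.E n | ∀ n, B.r (x n) = B.s (x (n + 1))} := by
    simp only [Set.ofPred_forall]
    refine isClosed_iInter fun n => ?_
    let φ : (∀ n, B.E n) → B.E n × B.E (n + 1) := fun x => (x n, x (n + 1))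
    have hφ : Continuous φ := (continuous_apply n).prodMk (continuous_apply (n + 1))
    exact (isClosed_discrete {p : B.E n × B.E (n + 1) | B.r p.1 = B.s p.2}).preimage hφ
  exact isCompact_iff_compactSpace.1 hc.isCompact

instance : SecondCountableTopology B.PathSpace := by
  let _ : ∀ n, TopologicalSpace (B.E n) := fun _ => ⊥
  have : ∀ n, DiscreteTopology (B.E n) := fun _ => ⟨rfl⟩
  exact TopologicalSpace.secondCountableTopology_induced _ (∀ n, B.E n) _

/-- Cylinders form neighbourhood bases. -/
theorem exists_cylinder_subset {x : B.PathSpace} {U : Set B.PathSpace} (hU : IsOpen U)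
    (hx : x ∈ U) : ∃ n, B.cylinder n x ⊆ U := by
  by_contra! hcon
  have hne : ∀ n, (B.cylinder n x ∩ Uᶜ).Nonempty := fun n => by
    obtain ⟨y, hy, hyU⟩ := Set.not_subset.1 (hcon n)
    exact ⟨y, hy, hyU⟩
  have hcl : ∀ n, IsClosed (B.cylinder n x ∩ Uᶜ) := fun n => by
    rw [cylinder_eq_preimage_head]
    exact (isClopen_preimage_head n _).1.inter hU.isClosed_compl
  -- If no cylinder around `x` fits in `U`, compactness gives a point outside `U` in all of them;
  -- that point is `x`.
  obtain ⟨y, hy⟩ := IsCompact.nonempty_iInter_of_sequence_nonempty_isCompact_isClosed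
    (fun n => B.cylinder n x ∩ Uᶜ)
    (fun n => Set.inter_subset_inter_left _ (cylinder_anti x (Nat.le_succ n)))
    hne (hcl 0).isCompact hcl
  rw [← Set.iInter_inter, iInter_cylinder] at hy
  obtain ⟨rfl, hyU⟩ := hy
  exact hyU hx

/-- A clopen subset of a closed set `Y` is cut out of `Y` by initial segments of one length. -/
theorem exists_clopen_eq_preimage_head {Y : Set B.PathSpace} (hY : IsClosed Y) {W : Set Y}
    (hW : IsClopen W) :
    ∃ (n : ℕ) (C : Set (∀ i : Fin (n + 1), B.E i)), W = Subtype.val ⁻¹' (head (n + 1) ⁻¹' C) := by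
  have : CompactSpace Y := isCompact_iff_compactSpace.1 hY.isCompact
  obtain ⟨O, hO, rfl⟩ := isOpen_induced_iff.1 hW.2
  -- Points whose membership in `O` is already decided by their first `n` edges; compactness makes
  -- one `n` serve all of the clopen set.
  let T : ℕ → Set Y := fun n => {x | Y ∩ B.cylinder n x.1 ⊆ O}
  have hcyl : ∀ {n} {x z : B.PathSpace}, z ∈ B.cylinder n x → B.cylinder n z = B.cylinder n x := by
    intro n x z hz
    rw [cylinder_eq_preimage_head] at hz
    rw [cylinder_eq_preimage_head, cylinder_eq_preimage_head, show head n z = head n x from hz]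
  have hTopen : ∀ n, IsOpen (T n) := by
    intro n
    rw [isOpen_iff_forall_mem_open]
    intro x hx
    refine ⟨Subtype.val ⁻¹' B.cylinder n x.1, fun y hy => ?_,
      (isOpen_cylinder n x.1).preimage continuous_subtype_val, mem_cylinder_self n x.1⟩
    change Y ∩ B.cylinder n y.1 ⊆ O
    rwa [hcyl hy]
  have hmono : Monotone T := by
    intro m n hmn x hx
    exact (Set.inter_subset_inter_right _ (cylinder_anti x.1 hmn)).trans hx
  obtain ⟨n, hn⟩ := hW.1.isCompact.elim_directed_cover T hTopen (fun x hx => by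
    obtain ⟨n, hn⟩ := exists_cylinder_subset hO hx
    exact Set.mem_iUnion.2 ⟨n, Set.inter_subset_right.trans hn⟩) hmono.directed_le
  refine ⟨n, head (n + 1) '' (Subtype.val '' (Subtype.val ⁻¹' O : Set Y)), ?_⟩
  ext y
  refine ⟨fun hy => ⟨y.1, ⟨y, hy, rfl⟩, rfl⟩, ?_⟩
  rintro ⟨_, ⟨x, hx, rfl⟩, hxy⟩
  have hx' := hmono (Nat.le_succ n) (hn hx)
  exact hx' ⟨y.2, fun i hi => (head_eq_iff.1 hxy i hi).symm⟩

end Topology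

/-! ### Cylinder weights and clopen values -/

section Measures

variable {B} (μ : Measure B.PathSpace)

theorem measurableSet_preimage_head (n : ℕ) (C : Set (∀ i : Fin n, B.E i)) :
    MeasurableSet (head n ⁻¹' C : Set B.PathSpace) :=
  (isOpen_preimage_head n C).measurableSet

open scoped Classical in
/-- The common measure of the cylinders given by finite paths of length `n + 1` that end at `v`. -/
noncomputable def weight (n : ℕ) (v : B.V (n + 1)) : ℝ :=
  -- The default `0` never occurs on a nonempty path space, by `exists_path_to`.
  if h : ∃ x : B.PathSpace, B.r (x.1 n) = v then μ.real (B.cylinder (n + 1) h.choose) else 0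

variable {μ}

theorem IsTailInvariant.real_cylinder (hinv : B.IsTailInvariant μ) (n : ℕ) (x : B.PathSpace) :
    μ.real (B.cylinder (n + 1) x) = weight μ n (B.r (x.1 n)) := by
  have h : ∃ y : B.PathSpace, B.r (y.1 n) = B.r (x.1 n) := ⟨x, rfl⟩
  rw [weight, dif_pos h, measureReal_def, measureReal_def, hinv n _ _ h.choose_spec]

theorem IsTailInvariant.real_preimage_head_singleton (hinv : B.IsTailInvariant μ) {n : ℕ}
    {c : ∀ i : Fin (n + 1), B.E i} (hc : c ∈ Set.range (head (B := B) (n + 1))) :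
    μ.real (head (n + 1) ⁻¹' {c} : Set B.PathSpace) = weight μ n (B.r (c (Fin.last n))) := by
  obtain ⟨x, rfl⟩ := hc
  rw [← cylinder_eq_preimage_head, hinv.real_cylinder]
  rfl

/-- The complement of the support is null because the path space is second countable. -/
theorem onSupport_real_preimage (A : Set B.PathSpace) :
    (onSupport μ).real (Subtype.val ⁻¹' A) = μ.real A := by
  have hm : MeasurableSet μ.support := Measure.isClosed_support.measurableSet
  rw [measureReal_def, measureReal_def, onSupport, comap_subtype_coe_apply hm,
    Subtype.image_preimage_coe, Set.inter_comm,
    measure_inter_conull Measure.measure_compl_support]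

variable [IsProbabilityMeasure μ]

theorem real_preimage_head (n : ℕ) (C : Finset (∀ i : Fin n, B.E i)) :
    μ.real (head n ⁻¹' (C : Set (∀ i : Fin n, B.E i)) : Set B.PathSpace) =
      ∑ c ∈ C, μ.real (head n ⁻¹' {c} : Set B.PathSpace) :=
  (sum_measureReal_preimage_singleton C fun _ _ => measurableSet_preimage_head _ _).symm

theorem IsTailInvariant.real_preimage_head_mem_span (hinv : B.IsTailInvariant μ) (n : ℕ)
    (C : Set (∀ i : Fin (n + 1), B.E i)) :
    μ.real (head (n + 1) ⁻¹' C : Set B.PathSpace) ∈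
      Submodule.span ℤ (Set.range (weight μ n)) := by
  have hC := C.toFinite
  rw [← hC.coe_toFinset, real_preimage_head]
  refine Submodule.sum_mem _ fun c _ => ?_
  -- A tuple of edges that is not composable gives the empty cylinder.
  by_cases hc : c ∈ Set.range (head (B := B) (n + 1))
  · rw [hinv.real_preimage_head_singleton hc]
    exact Submodule.subset_span ⟨_, rfl⟩
  · rw [Set.preimage_singleton_eq_empty.2 hc, measureReal_empty]
    exact Submodule.zero_mem _

/-- A cylinder ending at `v` splits according to its next edge; grouping these edges by range
produces the incidence numbers. -/
theorem IsTailInvariant.weight_eq_finsum (hinv : B.IsTailInvariant μ) (n : ℕ) (v : B.V (n + 1)) :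
    weight μ n v = ∑ᶠ w, (B.incidence (n + 1) w v : ℝ) * weight μ (n + 1) w := by
  classical
  have hne : Nonempty B.PathSpace := nonempty_of_isProbabilityMeasure μ
  have := Fintype.ofFinite (B.E (n + 1))
  have := Fintype.ofFinite (B.V (n + 1 + 1))
  obtain ⟨x, rfl⟩ := exists_path_to n v
  have hdec : B.cylinder (n + 1) x = ⋃ e ∈ Finset.univ.filter fun e : B.E (n + 1) =>
      B.s e = B.r (x.1 n), B.cylinder (n + 1) x ∩ {y | y.1 (n + 1) = e} := by
    ext y
    simp only [Finset.mem_filter, Finset.mem_univ, true_and, Set.mem_iUnion, Set.mem_inter_iff,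
      Set.mem_ofPred_eq, exists_prop, ↓existsAndEq, and_true]
    refine ⟨fun hy => ⟨?_, hy⟩, fun hy => hy.2⟩
    rw [← y.2 n, hy n (Nat.lt_succ_self n)]
  have hpiece : ∀ e ∈ Finset.univ.filter fun e : B.E (n + 1) => B.s e = B.r (x.1 n),
      μ.real (B.cylinder (n + 1) x ∩ {y | y.1 (n + 1) = e}) = weight μ (n + 1) (B.r e) := by
    intro e he
    obtain ⟨y, hy, rfl⟩ := exists_path_extending x n e (Finset.mem_filter.1 he).2.symm
    rw [← hinv.real_cylinder]
    congr 1
    ext z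
    simp only [cylinder, Set.mem_inter_iff, Set.mem_ofPred_eq]
    constructor
    · rintro ⟨h1, h2⟩ i hi
      rcases Nat.lt_succ_iff_lt_or_eq.1 hi with h | rfl
      · rw [h1 i h, hy i (by omega)]
      · exact h2
    · exact fun h => ⟨fun i hi => by rw [h i (by omega), hy i (by omega)], h _ (by omega)⟩
  rw [← hinv.real_cylinder, hdec, measureReal_biUnion_finset, Finset.sum_congr rfl hpiece,
    finsum_eq_sum_of_fintype, ← Finset.sum_fiberwise _ (fun e => B.r e)]
  · refine Finset.sum_congr rfl fun w _ => ?_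
    rw [Finset.sum_congr rfl (g := fun _ => weight μ (n + 1) w), Finset.sum_const, nsmul_eq_mul]
    · congr 2
      rw [incidence, Nat.card_eq_fintype_card, Fintype.card_subtype, Finset.filter_filter]
      simp only [and_comm]
    · intro e he
      rw [(Finset.mem_filter.1 he).2]
  · intro e _ e' _ hee
    refine Set.disjoint_left.2 fun y hy hy' => hee ?_
    rw [← hy.2, ← hy'.2]
  · exact fun e _ => ((isOpen_cylinder _ _).inter (isOpen_preimage_edge (n + 1) {e})).measurableSet

/-- The cylinders of a non-atomic measure become uniformly small. -/
theorem exists_forall_real_cylinder_lt [NullSingletonClass μ] {ε : ℝ} (hε : 0 < ε) :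
    ∃ n, ∀ x, μ.real (B.cylinder (n + 1) x) < ε := by
  let T : ℕ → Set B.PathSpace := fun n => {x | μ.real (B.cylinder n x) < ε}
  have hmono : Monotone T := fun m n hmn x hx =>
    (measureReal_mono (cylinder_anti x hmn)).trans_lt hx
  have hTopen : ∀ n, IsOpen (T n) := by
    intro n
    have : T n = head n ⁻¹' {c | μ.real (head n ⁻¹' {c} : Set B.PathSpace) < ε} := by
      ext x
      simp only [T, Set.mem_ofPred_eq, cylinder_eq_preimage_head, Set.mem_preimage]
    rw [this]
    exact isOpen_preimage_head n _
  have hcover : Set.univ ⊆ ⋃ n, T n := by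
    intro x _
    have hlim := tendsto_measure_iInter_atTop (μ := μ) (s := fun n => B.cylinder n x)
      (fun n => (isOpen_cylinder n x).measurableSet.nullMeasurableSet) (cylinder_anti x)
      ⟨0, measure_ne_top _ _⟩
    rw [iInter_cylinder, measure_singleton] at hlim
    have hlim' := (ENNReal.tendsto_toReal ENNReal.zero_ne_top).comp hlim
    obtain ⟨n, hn⟩ := (hlim'.eventually (gt_mem_nhds (by simpa using hε))).exists
    exact Set.mem_iUnion.2 ⟨n, hn⟩
  obtain ⟨n, hn⟩ := isCompact_univ.elim_directed_cover T hTopen hcover hmono.directed_le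
  exact ⟨n, fun x => hmono (Nat.le_succ n) (hn (Set.mem_univ x))⟩

/-- For a non-atomic tail-invariant measure on a diagram whose levels have bounded size, there are
arbitrarily many disjoint cylinders of the same positive measure. -/
theorem IsTailInvariant.exists_card_eq_real_eq [NullSingletonClass μ] (hinv : B.IsTailInvariant μ)
    {K : ℕ} (hK : ∀ n, Nat.card (B.V (n + 1)) ≤ K) (k : ℕ) :
    ∃ (n : ℕ) (C : Finset (∀ i : Fin n, B.E i)) (t : ℝ), C.card = k ∧ 0 < t ∧
      ∀ c ∈ C, μ.real (head n ⁻¹' {c} : Set B.PathSpace) = t := by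
  classical
  -- Cylinders this small must number more than `K * k` to have total mass `1`, so one of at most
  -- `K` end vertices receives more than `k` of them.
  have hε : (0 : ℝ) < 1 / (K * k + 1) := by positivity
  obtain ⟨n, hn⟩ := exists_forall_real_cylinder_lt (μ := μ) hε
  have := Fintype.ofFinite (∀ i : Fin (n + 1), B.E i)
  have := Fintype.ofFinite (B.V (n + 1))
  let P : Finset (∀ i : Fin (n + 1), B.E i) :=
    Finset.univ.filter fun c => 0 < μ.real (head (n + 1) ⁻¹' {c} : Set B.PathSpace)
  have hrange : ∀ c ∈ P, c ∈ Set.range (head (B := B) (n + 1)) := by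
    intro c hc
    by_contra hcon
    have h0 := (Finset.mem_filter.1 hc).2
    rw [Set.preimage_singleton_eq_empty.2 hcon, measureReal_empty] at h0
    exact lt_irrefl _ h0
  have hsum : ∑ c ∈ P, μ.real (head (n + 1) ⁻¹' {c} : Set B.PathSpace) = 1 := by
    rw [Finset.sum_filter_of_ne fun c _ hc => lt_of_le_of_ne measureReal_nonneg hc.symm,
      ← real_preimage_head, Finset.coe_univ, Set.preimage_univ, probReal_univ]
  have hcard : (1 : ℝ) ≤ P.card * (1 / (K * k + 1)) := by
    refine hsum.symm.le.trans ?_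
    rw [← nsmul_eq_mul]
    refine Finset.sum_le_card_nsmul _ _ _ fun c hc => ?_
    obtain ⟨x, rfl⟩ := hrange c hc
    rw [← cylinder_eq_preimage_head]
    exact (hn x).le
  have hcard' : K * k < P.card := by
    rw [mul_one_div, le_div_iff₀ (by positivity), one_mul] at hcard
    exact_mod_cast hcard
  obtain ⟨v, -, hv⟩ := Finset.exists_lt_card_fiber_of_mul_lt_card_of_maps_to (s := P)
    (t := Finset.univ) (n := k) (f := fun c => (B.r (c (Fin.last n)) : B.V (n + 1)))
    (fun _ _ => Finset.mem_univ _) (by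
      refine lt_of_le_of_lt (Nat.mul_le_mul_right k ?_) hcard'
      rw [Finset.card_univ, ← Nat.card_eq_fintype_card]
      exact hK n)
  have heq : ∀ c ∈ P.filter fun c => B.r (c (Fin.last n)) = v,
      μ.real (head (n + 1) ⁻¹' {c} : Set B.PathSpace) = weight μ n v := by
    intro c hc
    rw [Finset.mem_filter] at hc
    rw [hinv.real_preimage_head_singleton (hrange c hc.1), hc.2]
  obtain ⟨C, hCP, hC⟩ := Finset.exists_subset_card_eq hv.le
  obtain ⟨c₀, hc₀⟩ := Finset.card_pos.1 (Nat.zero_lt_of_lt hv)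
  refine ⟨n + 1, C, weight μ n v, hC, ?_, fun c hc => heq c (hCP hc)⟩
  rw [← heq c₀ hc₀]
  exact (Finset.mem_filter.1 (Finset.mem_filter.1 hc₀).1).2

theorem IsTailInvariant.clopenValues_onSupport (hinv : B.IsTailInvariant μ) {t : ℝ}
    (ht : t ∈ clopenValues (onSupport μ)) :
    ∃ n, t ∈ Submodule.span ℤ (Set.range (weight μ n)) := by
  obtain ⟨W, hW, rfl⟩ := ht
  obtain ⟨n, C, rfl⟩ := exists_clopen_eq_preimage_head Measure.isClosed_support hW
  refine ⟨n, ?_⟩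
  rw [onSupport_real_preimage]
  exact hinv.real_preimage_head_mem_span n C

theorem IsTailInvariant.inv_mem_clopenValues [NullSingletonClass μ] (hinv : B.IsTailInvariant μ)
    {K : ℕ} (hK : ∀ n, Nat.card (B.V (n + 1)) ≤ K) (hQ : QuotientCondition (onSupport μ))
    {k : ℕ} (hk : 0 < k) : (k : ℝ)⁻¹ ∈ clopenValues (onSupport μ) := by
  obtain ⟨n, C, t, hC, ht, hCt⟩ := hinv.exists_card_eq_real_eq hK k
  obtain ⟨c, hc⟩ := Finset.card_pos.1 (hC ▸ hk)
  let U : Set B.PathSpace := head n ⁻¹' (C : Set (∀ i : Fin n, B.E i))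
  let A : Set B.PathSpace := head n ⁻¹' {c}
  have hUA : A ⊆ U := Set.preimage_mono (Set.singleton_subset_iff.2 hc)
  have hU : μ.real U = k * t := by
    rw [real_preimage_head, Finset.sum_congr rfl hCt, Finset.sum_const, hC, nsmul_eq_mul]
  have hclopen : ∀ D : Set (∀ i : Fin n, B.E i),
      IsClopen (Subtype.val ⁻¹' (head n ⁻¹' D) : Set μ.support) :=
    fun D => (isClopen_preimage_head n D).preimage continuous_subtype_val
  have hk' : (0 : ℝ) < k := by exact_mod_cast hk
  -- A set of positive measure meets the support.
  have hUne : (Subtype.val ⁻¹' U : Set μ.support).Nonempty := by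
    have hpos : 0 < μ U := by
      refine pos_iff_ne_zero.2 fun h => ?_
      rw [measureReal_def, h, ENNReal.toReal_zero] at hU
      exact (mul_pos hk' ht).ne hU
    obtain ⟨x, hx, hxs⟩ := Measure.nonempty_inter_support_of_pos hpos
    exact ⟨⟨x, hxs⟩, hx⟩
  have hmeas : MeasurableSet (Subtype.val ⁻¹' U : Set μ.support) :=
    measurable_subtype_coe (measurableSet_preimage_head n _)
  have hQU : clopenValues _ = clopenValues _ := hQ _ (hclopen C) hUne
  rw [← hQU]
  refine ⟨Subtype.val ⁻¹' A, hclopen {c}, ?_⟩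
  rw [measureReal_def, ProbabilityTheory.cond_apply hmeas, ENNReal.toReal_mul,
    ENNReal.toReal_inv, ← measureReal_def, ← measureReal_def, ← Set.preimage_inter,
    Set.inter_eq_self_of_subset_right hUA, onSupport_real_preimage,
    onSupport_real_preimage, hCt c hc, hU]
  field_simp

end Measures

end BratteliDiagram

/-! ### The main theorem -/

open BratteliDiagram in
theorem mainTheorem5 (B : BratteliDiagram) (hB : B.IsStationary)
    (μ : Measure B.PathSpace) [IsProbabilityMeasure μ] [NullSingletonClass μ]
    (hinv : B.IsTailInvariant μ) (herg : B.IsTailErgodic μ) :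
    ¬ QuotientCondition (onSupport μ) := by
  intro hQ
  obtain ⟨K, F, σ, hσ⟩ := hB
  have hK : ∀ n, Nat.card (B.V (n + 1)) ≤ K := fun n => by simp [← Nat.card_congr (σ n)]
  -- The identifications `σ` turn the weights of all levels into vectors over one index set, related
  -- by the single matrix `F`.
  obtain ⟨k, hk, hkn⟩ := exists_inv_notMem_span F (fun n i => weight μ n (σ n i)) fun n i => by
    rw [hinv.weight_eq_finsum, ← finsum_comp_equiv (σ (n + 1))]
    simp only [← hσ n, Matrix.submatrix_apply]
  obtain ⟨n, hn⟩ := hinv.clopenValues_onSupport (hinv.inv_mem_clopenValues hK hQ hk)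
  refine hkn n ?_
  rwa [show (fun i => weight μ n (σ n i)) = weight μ n ∘ σ n from rfl, (σ n).surjective.range_comp]
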